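/- Let $s(n,k)$ ($n\ge 1$, $k\in\mathbb Z$) be Stern's array: $s(1,1)=1$, $s(1,k)=0$ for $k\neq 1$, and for $n\ge 2$, $s(n,2k)=s(n-1,k)$ and $s(n,2k+1)=s(n-1,k)+s(n-1,k+1)$. For $f:\mathbb R^2\to\mathbb R$ put $S_n(f)=\sum_{k=0}^{2^n-1} f\bigl(s(n,k),s(n,k+1)\bigr)$; the pairs $(s(n,k),s(n,k+1))$ for all other $k\in\mathbb Z$ are $(0,0)$, so if $f(0,0)=0$ this is the sum over all $k\in\mathbb Z$. For $r\ge 0$ of a fixed parity let $[a_1,a_2,a_3]_r$ denote the function of $r$ with period $6$ whose values are $a_1,a_2,a_3$ at $r=0,2,4$ (if $r$ is even) or at $r=1,3,5$ (if $r$ is odd). (1) Let $r$ be odd. There are an integer $\ell\ge 0$ with $\ell\le \frac r3+[\frac23,0,\frac13]_r$ and real constants $a_1,\dots,a_\ell$, depending only on $r$, such that for every real homogeneous polynomial $f(x,y)$ of degree $r$, $S_n(f)=\sum_{j=1}^{\ell}a_jS_{n-j}(f)$ for all sufficiently large $n$. (2) Let $r\ge 0$ be even. There are an integer $\ell\ge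 0$ with $\ell\le \frac r3+[4,\frac{10}3,\frac83]_r$ and real constants $a_1,\dots,a_\ell$, depending only on $r$, such that for every real homogeneous polynomial $f(x,y)$ of degree $r$, $S_n(f)=\sum_{j=1}^{\ell}a_jS_{n-j}(f)$ for all sufficiently large $n$. (3) Let $r\ge 0$ be even. There are an integer $\ell\ge 0$ with $\ell\le \frac r3+[2,\frac43,\frac23]_r$ and real constants $a_1,\dots,a_\ell$, depending only on $r$, such that for every real homogeneous polynomial $f(x,y)$ of degree $r$ there are real constants $b,c$ with $S_n(f)=\sum_{j=1}^{\ell}a_jS_{n-j}(f)+b+c(-1)^n$ for all sufficiently large $n$. -/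

import Mathlib

/-- Stern's array, with rows `n ≥ 1` and columns `k : ℤ`. There is no row `0`; the value there is a
placeholder. -/
def stern : ℕ → ℤ → ℕ
  | 0, _ => 0
  | 1, k => if k = 1 then 1 else 0
  | n + 2, k =>
    if Even k then stern (n + 1) (k / 2)
    else stern (n + 1) (k / 2) + stern (n + 1) (k / 2 + 1)

theorem stern_two_mul (n : ℕ) (k : ℤ) : stern (n + 2) (2 * k) = stern (n + 1) k := by
  simp [stern]

theorem stern_two_mul_add_one (n : ℕ) (k : ℤ) :
    stern (n + 2) (2 * k + 1) = stern (n + 1) k + stern (n + 1) (k + 1) := by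
  have h1 : ¬ Even (2 * k + 1) := by simp
  have h2 : (2 * k + 1) / 2 = k := by omega
  simp only [stern, if_neg h1, h2]

/-- The entries of row `n` outside columns `1, …, 2 ^ n - 1` vanish. -/
theorem stern_eq_zero (n : ℕ) (k : ℤ) (h : k ≤ 0 ∨ 2 ^ n ≤ k) : stern n k = 0 := by
  induction n using Nat.twoStepInduction generalizing k with
  | zero => rfl
  | one =>
    have : k ≠ 1 := by omega
    simp [stern, this]
  | more n _ ih =>
    rcases Int.even_or_odd' k with ⟨m, rfl | rfl⟩
    · rw [stern_two_mul]
      apply ih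
      rw [pow_succ] at h
      omega
    · rw [stern_two_mul_add_one, ih m, ih (m + 1)]
      all_goals
        rw [pow_succ] at h
        have : (2 : ℤ) ^ (n + 1) = 2 * 2 ^ n := by ring
        omega

/-- `S_n(f) = ∑_k f(s(n,k), s(n,k+1))`, over `0 ≤ k < 2 ^ n`. All other pairs of neighbours in row
`n` are `(0, 0)`, so for `f(0,0) = 0` this is the sum over all `k : ℤ`
(see `sternSum_eq_finsum`). -/
noncomputable def sternSum (n : ℕ) (f : ℝ → ℝ → ℝ) : ℝ :=
  ∑ k ∈ Finset.Ico (0 : ℤ) (2 ^ n), f (stern n k) (stern n (k + 1))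

theorem sternSum_eq_finsum (n : ℕ) (f : ℝ → ℝ → ℝ) (hf : f 0 0 = 0) :
    sternSum n f = ∑ᶠ k : ℤ, f (stern n k) (stern n (k + 1)) := by
  rw [sternSum, finsum_eq_sum_of_support_subset]
  intro k hk
  by_contra hk'
  apply hk
  simp only [Finset.coe_Ico, Set.mem_Ico, not_and_or, not_le, not_lt] at hk'
  show f (stern n k) (stern n (k + 1)) = 0
  rw [stern_eq_zero n k (by omega), stern_eq_zero n (k + 1) (by omega)]
  simpa using hf

/-- The polynomial function `(x, y) ↦ f(x, y)` of a bivariate real polynomial. -/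
noncomputable def polyFun (f : MvPolynomial (Fin 2) ℝ) (x y : ℝ) : ℝ :=
  MvPolynomial.eval ![x, y] f

/-- The periodic function `[a₁, …, a_p]_r`, for `r` restricted to one parity: it has period `2p`,
and `a₁, a₂, …` occur at `r = 0, 2, …` for even `r`, and at `r = 1, 3, …` for odd `r`. -/
def bracket {p : ℕ} [NeZero p] (a : Fin p → ℚ) (r : ℕ) : ℚ :=
  a (Fin.ofNat p (r / 2))

/-! Each row of the array comes from the previous one by inserting mediants, so `S_{n+1}(f) = S_n(T
f)` with `T = sternOp`, for `n ≥ 1`. A monic polynomial in `T` that kills `f` is thus a recurrence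
for `S_n(f)`. Rows are palindromic, so only the symmetrization of `f` matters, and `T` preserves the
symmetric forms of degree `r`.

That space has dimension about `r/2`; the bound near `r/3` comes from the third variable `z = -(x +
y)`. Let `E` be the degree-`r` part of `ℝ[e₂, e₃]`, of dimension about `r/6`, and `m` a symmetrized
monomial with exponents `i, j`. If `r` is even, `m + T m` (`i, j` even) or `m - T m` (`i, j` odd) is
symmetric in `x, y, z`, so `T² - 1` maps into `(T - 1)E + (T + 1)E`. If `r` is odd, `T m` lies in
the span of `z` and a traceless `z²` over `ℝ[e₂, e₃]`, again about `2 · r/6` dimensions.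
Cayley–Hamilton on the image of `T² - 1` or `T` gives the polynomial. The factor `T² - 1` costs two
more terms, or the correction `b + c(-1)^n`; the factor `T` only delays the start. -/

open Polynomial

/-! ### Stern sums and the mediant operator -/

/-- The operator `(T f)(x, y) = f(x, x + y) + f(x + y, y)` on functions of two variables. -/
def sternOp : Module.End ℝ (ℝ → ℝ → ℝ) where
  toFun f := fun x y => f x (x + y) + f (x + y) y
  map_add' f g := by ext x y; simp only [Pi.add_apply]; ring
  map_smul' c f := by ext x y; simp only [Pi.smul_apply, smul_eq_mul, RingHom.id_apply]; ring

theorem sternOp_apply (f : ℝ → ℝ → ℝ) (x y : ℝ) :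
    sternOp f x y = f x (x + y) + f (x + y) y := rfl

/-- `sternSum n` as a linear functional. -/
noncomputable def sternSumLin (n : ℕ) : (ℝ → ℝ → ℝ) →ₗ[ℝ] ℝ where
  toFun f := sternSum n f
  map_add' f g := by simp [sternSum, Finset.sum_add_distrib]
  map_smul' c f := by simp [sternSum, Finset.mul_sum]

theorem sternSumLin_apply (n : ℕ) (f : ℝ → ℝ → ℝ) : sternSumLin n f = sternSum n f := rfl

theorem sum_range_two_mul {M : Type*} [AddCommMonoid M] (g : ℕ → M) (N : ℕ) :
    ∑ k ∈ Finset.range (2 * N), g k = ∑ k ∈ Finset.range N, (g (2 * k) + g (2 * k + 1)) := by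
  induction N with
  | zero => simp
  | succ N ih =>
    rw [Finset.sum_range_succ, ← ih, show 2 * (N + 1) = 2 * N + 1 + 1 by ring,
      Finset.sum_range_succ, Finset.sum_range_succ, add_assoc]

theorem sternSum_eq_sum_range (n : ℕ) (f : ℝ → ℝ → ℝ) :
    sternSum n f = ∑ k ∈ Finset.range (2 ^ n), f (stern n k) (stern n (k + 1)) := by
  rw [sternSum]
  symm
  refine Finset.sum_bij (fun k _ => (k : ℤ)) ?_ ?_ ?_ ?_
  · intro k hk
    have := Finset.mem_range.mp hk
    simp only [Finset.mem_Ico, Nat.cast_nonneg, true_and]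
    exact_mod_cast this
  · intro a _ b _ h
    exact_mod_cast h
  · intro b hb
    obtain ⟨h0, h1⟩ := Finset.mem_Ico.mp hb
    lift b to ℕ using h0
    exact ⟨b, Finset.mem_range.mpr (by exact_mod_cast h1), rfl⟩
  · intros; rfl

theorem sternSum_succ (n : ℕ) (f : ℝ → ℝ → ℝ) :
    sternSum (n + 2) f = sternSum (n + 1) (sternOp f) := by
  rw [sternSum_eq_sum_range, sternSum_eq_sum_range, pow_succ, mul_comm, sum_range_two_mul]
  refine Finset.sum_congr rfl fun k _ => ?_
  have h : (2 * (k : ℤ) + 1 + 1) = 2 * (k + 1) := by ring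
  push_cast
  rw [h, stern_two_mul, stern_two_mul_add_one, stern_two_mul, sternOp_apply]
  push_cast
  rfl

theorem sternSum_sternOp_pow (n i : ℕ) (f : ℝ → ℝ → ℝ) :
    sternSum (n + 1) ((sternOp ^ i) f) = sternSum (n + 1 + i) f := by
  induction i generalizing n with
  | zero => rfl
  | succ i ih =>
    rw [pow_succ', Module.End.mul_apply, ← sternSum_succ, ih (n + 1)]
    congr 1
    omega

/-- Swapping the variables commutes with `sternOp`, and row one has just the pairs `(0, 1)` and `(1,
0)`. -/
theorem sternSum_swap (n : ℕ) (f : ℝ → ℝ → ℝ) :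
    sternSum (n + 1) (fun x y => f y x) = sternSum (n + 1) f := by
  induction n generalizing f with
  | zero =>
    simp [sternSum_eq_sum_range, Finset.sum_range_succ, stern, add_comm]
  | succ n ih =>
    rw [sternSum_succ, sternSum_succ, ← ih (sternOp f)]
    congr 1
    ext x y
    simp only [sternOp_apply]
    rw [add_comm, add_comm x y]

theorem sternSum_recurrence {p : ℝ[X]} (hp : p.Monic) (f : ℝ → ℝ → ℝ) (n : ℕ)
    (hn : p.natDegree < n) :
    sternSum n f = (∑ j ∈ Finset.Icc 1 p.natDegree, -p.coeff (p.natDegree - j) *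
      sternSum (n - j) f) + sternSum (n - p.natDegree) (aeval sternOp p f) := by
  set l := p.natDegree with hl
  obtain ⟨m, rfl⟩ : ∃ m, n = m + 1 + l := ⟨n - 1 - l, by omega⟩
  have h1 : sternSum (m + 1) (aeval sternOp p f) =
      ∑ i ∈ Finset.range (l + 1), p.coeff i * sternSum (m + 1 + i) f := by
    rw [aeval_eq_sum_range, ← sternSumLin_apply, LinearMap.sum_apply, map_sum]
    refine Finset.sum_congr rfl fun i _ => ?_
    rw [LinearMap.smul_apply, map_smul, sternSumLin_apply, sternSum_sternOp_pow, smul_eq_mul]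
  have h2 : p.coeff l = 1 := hp
  have h3 : ∑ j ∈ Finset.Icc 1 l, -p.coeff (l - j) * sternSum (m + 1 + l - j) f =
      -∑ i ∈ Finset.range l, p.coeff i * sternSum (m + 1 + i) f := by
    rw [← Finset.sum_neg_distrib]
    refine Finset.sum_nbij' (fun j => l - j) (fun i => l - i) ?_ ?_ ?_ ?_ ?_
    all_goals
      intro j hj
      simp only [Finset.mem_Icc, Finset.mem_range] at hj ⊢
    any_goals omega
    rw [show m + 1 + l - j = m + 1 + (l - j) by omega]
    ring
  rw [h3, show m + 1 + l - l = m + 1 by omega, h1, Finset.sum_range_succ, h2]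
  ring

theorem exists_monic_aeval_eq_zero_on {K E : Type*} [Field K] [AddCommGroup E] [Module K E]
    (T : Module.End K E) (Y : Submodule K E) [FiniteDimensional K Y]
    (hY : ∀ y ∈ Y, T y ∈ Y) :
    ∃ p : K[X], p.Monic ∧ p.natDegree = Module.finrank K Y ∧ ∀ y ∈ Y, aeval T p y = 0 := by
  refine ⟨(T.restrict hY).charpoly, LinearMap.charpoly_monic _, LinearMap.charpoly_natDegree _,
    fun y hy => ?_⟩
  have h := LinearMap.congr_fun (LinearMap.aeval_self_charpoly (T.restrict hY)) ⟨y, hy⟩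
  have hpow : ∀ i : ℕ, (((T.restrict hY) ^ i) ⟨y, hy⟩ : E) = (T ^ i) y := by
    intro i
    induction i with
    | zero => rfl
    | succ i ih => simp only [pow_succ', Module.End.mul_apply, LinearMap.coe_restrict_apply, ih]
  have h2 := congrArg Subtype.val h
  rw [aeval_eq_sum_range, LinearMap.sum_apply] at h2 ⊢
  simpa only [LinearMap.smul_apply, hpow, Submodule.coe_sum, Submodule.coe_smul,
    LinearMap.zero_apply, Submodule.coe_zero] using h2

/-! ### Symmetric forms in two variables -/

/-- The function `x ^ i * y ^ j + x ^ j * y ^ i`. -/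
def symmMonomial (i j : ℕ) : ℝ → ℝ → ℝ := fun x y => x ^ i * y ^ j + x ^ j * y ^ i

theorem symmMonomial_comm (i j : ℕ) : symmMonomial i j = symmMonomial j i := by
  ext x y; simp only [symmMonomial]; ring

/-- The symmetric forms of degree `r` in two variables, as functions. -/
def symmForms (r : ℕ) : Submodule ℝ (ℝ → ℝ → ℝ) :=
  Submodule.span ℝ {g | ∃ i j, i + j = r ∧ g = symmMonomial i j}

theorem symmMonomial_mem {r i j : ℕ} (h : i + j = r) : symmMonomial i j ∈ symmForms r :=
  Submodule.subset_span ⟨i, j, h, rfl⟩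

theorem sternOp_symmMonomial (i j : ℕ) : sternOp (symmMonomial i j) =
    ∑ t ∈ Finset.range (j + 1), (j.choose t : ℝ) • symmMonomial (i + t) (j - t) +
    ∑ t ∈ Finset.range (i + 1), (i.choose t : ℝ) • symmMonomial (j + t) (i - t) := by
  have key : ∀ (i j : ℕ) (x y : ℝ),
      ∑ t ∈ Finset.range (j + 1), (j.choose t : ℝ) * symmMonomial (i + t) (j - t) x y =
        x ^ i * (x + y) ^ j + (x + y) ^ j * y ^ i := by
    intro i j x y
    have h2 : (x + y) ^ j * y ^ i = (y + x) ^ j * y ^ i := by rw [add_comm]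
    rw [h2, add_pow, add_pow, Finset.mul_sum, Finset.sum_mul, ← Finset.sum_add_distrib]
    refine Finset.sum_congr rfl fun t _ => ?_
    simp only [symmMonomial]
    ring
  ext x y
  simp only [Pi.add_apply, Finset.sum_apply, Pi.smul_apply, smul_eq_mul, key, sternOp_apply]
  simp only [symmMonomial]
  ring

theorem sternOp_mem_symmForms {r : ℕ} {g : ℝ → ℝ → ℝ} (hg : g ∈ symmForms r) :
    sternOp g ∈ symmForms r := by
  induction hg using Submodule.span_induction with
  | mem g hg =>
    obtain ⟨i, j, h, rfl⟩ := hg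
    rw [sternOp_symmMonomial]
    refine add_mem (sum_mem fun t ht => Submodule.smul_mem _ _ (symmMonomial_mem ?_))
      (sum_mem fun t ht => Submodule.smul_mem _ _ (symmMonomial_mem ?_))
    all_goals
      have := Finset.mem_range.mp ht
      omega
  | zero => simp
  | add a b _ _ ha hb => rw [map_add]; exact add_mem ha hb
  | smul c a _ ha => rw [map_smul]; exact Submodule.smul_mem _ _ ha

theorem polyFun_add_swap_mem {r : ℕ} {f : MvPolynomial (Fin 2) ℝ} (hf : f.IsHomogeneous r) :
    (polyFun f + fun x y => polyFun f y x) ∈ symmForms r := by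
  have h : (polyFun f + fun x y => polyFun f y x) =
      ∑ d ∈ f.support, f.coeff d • symmMonomial (d 0) (d 1) := by
    ext x y
    simp only [Pi.add_apply, Finset.sum_apply, Pi.smul_apply, smul_eq_mul, polyFun,
      MvPolynomial.eval_eq', Fin.prod_univ_two, Matrix.cons_val_zero, Matrix.cons_val_one,
      ← Finset.sum_add_distrib]
    refine Finset.sum_congr rfl fun d _ => ?_
    simp only [symmMonomial]
    ring
  rw [h]
  refine sum_mem fun d hd => Submodule.smul_mem _ _ (symmMonomial_mem ?_)
  have := hf (MvPolynomial.mem_support_iff.mp hd)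
  simpa [Finsupp.weight_apply, Finsupp.sum_fintype] using this

/-! ### Symmetric functions of three variables with sum zero -/

/-- The linear form `-(x + y)`, completing `x, y` to three variables with sum zero. -/
def thirdVar : ℝ → ℝ → ℝ := fun x y => -(x + y)

/-- The second elementary symmetric function of `x, y, -(x + y)`. -/
def elemTwo : ℝ → ℝ → ℝ := fun x y => -(x ^ 2 + x * y + y ^ 2)

/-- The third elementary symmetric function of `x, y, -(x + y)`. -/
def elemThree : ℝ → ℝ → ℝ := fun x y => -(x * y * (x + y))

/-- The `n`-th power sum of `x, y, -(x + y)`. -/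
def powSum (n : ℕ) : ℝ → ℝ → ℝ := fun x y => x ^ n + y ^ n + (-(x + y)) ^ n

theorem powSum_add_three (n : ℕ) :
    powSum (n + 3) = elemThree * powSum n - elemTwo * powSum (n + 1) := by
  ext x y
  simp only [powSum, elemTwo, elemThree, Pi.mul_apply, Pi.sub_apply]
  ring

theorem thirdVar_pow_add_three (n : ℕ) :
    thirdVar ^ (n + 3) = elemThree * thirdVar ^ n - elemTwo * thirdVar ^ (n + 1) := by
  ext x y
  simp only [thirdVar, elemTwo, elemThree, Pi.mul_apply, Pi.sub_apply, Pi.pow_apply]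
  ring

/-- The span of the functions `elemTwo ^ a * elemThree ^ b * h` with `2 a + 3 b + d = n`. -/
def elemSpan (h : ℝ → ℝ → ℝ) (d n : ℕ) : Submodule ℝ (ℝ → ℝ → ℝ) :=
  Submodule.span ℝ {g | ∃ a b, 2 * a + 3 * b + d = n ∧ g = elemTwo ^ a * elemThree ^ b * h}

theorem mem_elemSpan {h : ℝ → ℝ → ℝ} {d n : ℕ} (a b : ℕ) (hab : 2 * a + 3 * b + d = n) :
    elemTwo ^ a * elemThree ^ b * h ∈ elemSpan h d n :=
  Submodule.subset_span ⟨a, b, hab, rfl⟩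

theorem elemSpan_mul_mem {h g : ℝ → ℝ → ℝ} {d m n : ℕ} (a b : ℕ) (hg : g ∈ elemSpan h d n)
    (hm : 2 * a + 3 * b + n = m) : elemTwo ^ a * elemThree ^ b * g ∈ elemSpan h d m := by
  induction hg using Submodule.span_induction with
  | mem g hg =>
    obtain ⟨a', b', h', rfl⟩ := hg
    refine Submodule.subset_span ⟨a + a', b + b', by omega, ?_⟩
    ring
  | zero => simp
  | add u v _ _ hu hv => rw [mul_add]; exact add_mem hu hv
  | smul c u _ hu => rw [mul_smul_comm]; exact Submodule.smul_mem _ _ hu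

theorem mul_mem_elemSpan {h u g : ℝ → ℝ → ℝ} {d m n : ℕ} (hu : u ∈ elemSpan 1 0 m)
    (hg : g ∈ elemSpan h d n) : u * g ∈ elemSpan h d (m + n) := by
  induction hu using Submodule.span_induction with
  | mem u hu =>
    obtain ⟨a, b, h', rfl⟩ := hu
    rw [mul_one]
    exact elemSpan_mul_mem a b hg (by omega)
  | zero => simp
  | add u v _ _ hu hv => rw [add_mul]; exact add_mem hu hv
  | smul c u _ hu => rw [smul_mul_assoc]; exact Submodule.smul_mem _ _ hu

theorem powSum_mem (n : ℕ) : powSum n ∈ elemSpan 1 0 n := by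
  induction n using Nat.strong_induction_on with
  | _ n ih =>
    match n, ih with
    | 0, _ =>
      have : powSum 0 = (3 : ℝ) • (elemTwo ^ 0 * elemThree ^ 0 * 1) := by
        ext x y; simp [powSum]; norm_num
      rw [this]
      exact Submodule.smul_mem _ _ (mem_elemSpan 0 0 rfl)
    | 1, _ =>
      have : powSum 1 = 0 := by ext x y; simp [powSum]
      rw [this]
      exact zero_mem _
    | 2, _ =>
      have : powSum 2 = (-2 : ℝ) • (elemTwo ^ 1 * elemThree ^ 0 * 1) := by
        ext x y; simp [powSum, elemTwo]; ring
      rw [this]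
      exact Submodule.smul_mem _ _ (mem_elemSpan 1 0 rfl)
    | n + 3, ih =>
      have h0 := elemSpan_mul_mem 0 1 (ih n (by omega)) (m := n + 3) (by omega)
      have h1 := elemSpan_mul_mem 1 0 (ih (n + 1) (by omega)) (m := n + 3) (by omega)
      rw [powSum_add_three]
      simpa using sub_mem h0 h1

/-- The parity of `b` is that of `n - d`, so `b / 2` alone determines the generator. -/
theorem finrank_elemSpan_le (h : ℝ → ℝ → ℝ) (d n N : ℕ)
    (hN : ∀ a b, 2 * a + 3 * b + d = n → b / 2 < N) :
    FiniteDimensional ℝ (elemSpan h d n) ∧ Module.finrank ℝ (elemSpan h d n) ≤ N := by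
  classical
  set s : Finset (ℝ → ℝ → ℝ) := (Finset.range N).image fun t =>
    elemTwo ^ ((n - d - 3 * (2 * t + (n - d) % 2)) / 2) *
      elemThree ^ (2 * t + (n - d) % 2) * h with hs
  have hle : elemSpan h d n ≤ Submodule.span ℝ (s : Set (ℝ → ℝ → ℝ)) := by
    refine Submodule.span_mono ?_
    rintro g ⟨a, b, hab, rfl⟩
    rw [hs, Finset.coe_image]
    refine ⟨b / 2, by simpa using hN a b hab, ?_⟩
    have hb : 2 * (b / 2) + (n - d) % 2 = b := by omega
    have ha : (n - d - 3 * b) / 2 = a := by omega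
    simp only [hb, ha]
  have hfin : FiniteDimensional ℝ (Submodule.span ℝ (s : Set (ℝ → ℝ → ℝ))) :=
    FiniteDimensional.span_finset ℝ s
  refine ⟨Submodule.finiteDimensional_of_le hle, ?_⟩
  calc Module.finrank ℝ (elemSpan h d n)
      ≤ Module.finrank ℝ (Submodule.span ℝ (s : Set (ℝ → ℝ → ℝ))) := Submodule.finrank_mono hle
    _ ≤ s.card := finrank_span_finset_le_card s
    _ ≤ N := by simpa using Finset.card_image_le (s := Finset.range N)

/-! ### The image of the operator -/

/-- The right side sums `u^i v^j` over ordered pairs of distinct variables among `x, y, z`. The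
pairs from `x, y` give the symmetrized monomial; those involving `z` give its image, up to a sign
fixed by parity. -/
theorem symmMonomial_add_sternOp {i j : ℕ} (hi : Even i) (hj : Even j) :
    symmMonomial i j + sternOp (symmMonomial i j) = powSum i * powSum j - powSum (i + j) := by
  ext x y
  simp only [Pi.add_apply, Pi.sub_apply, Pi.mul_apply, sternOp_apply, symmMonomial, powSum,
    hi.neg_pow, hj.neg_pow, (hi.add hj).neg_pow]
  ring

theorem symmMonomial_sub_sternOp {i j : ℕ} (hi : Odd i) (hj : Odd j) :
    symmMonomial i j - sternOp (symmMonomial i j) = powSum i * powSum j - powSum (i + j) := by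
  ext x y
  simp only [Pi.sub_apply, Pi.mul_apply, sternOp_apply, symmMonomial, powSum,
    hi.neg_pow, hj.neg_pow, (hi.add_odd hj).neg_pow]
  ring

theorem sternOp_symmMonomial_of_even_of_odd {i j : ℕ} (hi : Even i) (hj : Odd j) :
    sternOp (symmMonomial i j) = powSum j * thirdVar ^ i - powSum i * thirdVar ^ j := by
  ext x y
  simp only [Pi.sub_apply, Pi.mul_apply, Pi.pow_apply, sternOp_apply, symmMonomial, powSum,
    thirdVar, hi.neg_pow, hj.neg_pow]
  ring

theorem powSum_mul_sub_mem (i j : ℕ) :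
    powSum i * powSum j - powSum (i + j) ∈ elemSpan 1 0 (i + j) :=
  sub_mem (mul_mem_elemSpan (powSum_mem i) (powSum_mem j)) (powSum_mem _)

theorem sternOp_sq_sub_one_mem {r : ℕ} (hr : Even r) {g : ℝ → ℝ → ℝ} (hg : g ∈ symmForms r) :
    (sternOp ^ 2 - 1 : Module.End ℝ (ℝ → ℝ → ℝ)) g ∈
      (elemSpan 1 0 r).map (sternOp - 1) ⊔ (elemSpan 1 0 r).map (sternOp + 1) := by
  induction hg using Submodule.span_induction with
  | mem g hg =>
    obtain ⟨i, j, rfl, rfl⟩ := hg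
    rcases Nat.even_or_odd i with hi | hi
    · have hj : Even j := (Nat.even_add.mp hr).mp hi
      refine Submodule.mem_sup_left ⟨_, powSum_mul_sub_mem i j, ?_⟩
      rw [← symmMonomial_add_sternOp hi hj]
      simp only [pow_two, LinearMap.sub_apply, Module.End.mul_apply, Module.End.one_apply, map_add]
      abel
    · have hj : Odd j := by
        rcases Nat.even_or_odd j with h | h
        · exact absurd ((Nat.even_add.mp hr).mpr h) (Nat.not_even_iff_odd.mpr hi)
        · exact h
      refine Submodule.mem_sup_right ⟨_, neg_mem (powSum_mul_sub_mem i j), ?_⟩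
      rw [← symmMonomial_sub_sternOp hi hj]
      simp only [pow_two, LinearMap.sub_apply, LinearMap.add_apply, Module.End.mul_apply,
        Module.End.one_apply, map_neg, map_sub]
      abel
  | zero => simp
  | add a b _ _ ha hb => rw [map_add]; exact add_mem ha hb
  | smul c a _ ha => rw [map_smul]; exact Submodule.smul_mem _ _ ha

/-- The traceless part of `thirdVar ^ 2` over the symmetric functions. -/
noncomputable def tracelessSq : ℝ → ℝ → ℝ := thirdVar ^ 2 + (2 / 3 : ℝ) • elemTwo

/-- Both `z^n` and `p_n` obey the recursion from `z³ = e₃ - e₂ z`. Subtracting the mean of `x^n,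
y^n, z^n` removes the component of `z^n` along `1`. -/
theorem thirdVar_pow_sub_mem (n : ℕ) : thirdVar ^ n - (1 / 3 : ℝ) • powSum n ∈
    elemSpan thirdVar 1 n ⊔ elemSpan tracelessSq 2 n := by
  induction n using Nat.strong_induction_on with
  | _ n ih =>
    match n, ih with
    | 0, _ =>
      have : thirdVar ^ 0 - (1 / 3 : ℝ) • powSum 0 = 0 := by
        ext x y; simp [powSum]; norm_num
      rw [this]
      exact zero_mem _
    | 1, _ =>
      have : thirdVar ^ 1 - (1 / 3 : ℝ) • powSum 1 = elemTwo ^ 0 * elemThree ^ 0 * thirdVar := by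
        ext x y; simp [powSum]
      rw [this]
      exact Submodule.mem_sup_left (mem_elemSpan 0 0 rfl)
    | 2, _ =>
      have : thirdVar ^ 2 - (1 / 3 : ℝ) • powSum 2 =
          elemTwo ^ 0 * elemThree ^ 0 * tracelessSq := by
        ext x y; simp [powSum, tracelessSq, thirdVar, elemTwo]; ring
      rw [this]
      exact Submodule.mem_sup_right (mem_elemSpan 0 0 rfl)
    | n + 3, ih =>
      have key : ∀ {m : ℕ} (a b : ℕ) {g : ℝ → ℝ → ℝ},
          g ∈ elemSpan thirdVar 1 m ⊔ elemSpan tracelessSq 2 m → 2 * a + 3 * b + m = n + 3 →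
          elemTwo ^ a * elemThree ^ b * g ∈
            elemSpan thirdVar 1 (n + 3) ⊔ elemSpan tracelessSq 2 (n + 3) := by
        intro m a b g hg hm
        obtain ⟨u, hu, v, hv, rfl⟩ := Submodule.mem_sup.mp hg
        rw [mul_add]
        exact Submodule.add_mem_sup (elemSpan_mul_mem a b hu hm) (elemSpan_mul_mem a b hv hm)
      have h := sub_mem (key 0 1 (ih n (by omega)) (by omega))
        (key 1 0 (ih (n + 1) (by omega)) (by omega))
      convert h using 1
      rw [thirdVar_pow_add_three, powSum_add_three]
      ext x y
      simp only [Pi.sub_apply, Pi.mul_apply, Pi.smul_apply, Pi.pow_apply, smul_eq_mul]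
      ring

theorem sternOp_mem_of_odd {r : ℕ} (hr : Odd r) {g : ℝ → ℝ → ℝ} (hg : g ∈ symmForms r) :
    sternOp g ∈ elemSpan thirdVar 1 r ⊔ elemSpan tracelessSq 2 r := by
  have key : ∀ i j : ℕ, powSum j * (thirdVar ^ i - (1 / 3 : ℝ) • powSum i) ∈
      elemSpan thirdVar 1 (j + i) ⊔ elemSpan tracelessSq 2 (j + i) := by
    intro i j
    obtain ⟨u, hu, v, hv, h⟩ := Submodule.mem_sup.mp (thirdVar_pow_sub_mem i)
    rw [← h, mul_add]
    exact Submodule.add_mem_sup (mul_mem_elemSpan (powSum_mem j) hu)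
      (mul_mem_elemSpan (powSum_mem j) hv)
  have main : ∀ i j : ℕ, Even i → Odd j → i + j = r → sternOp (symmMonomial i j) ∈
      elemSpan thirdVar 1 r ⊔ elemSpan tracelessSq 2 r := by
    rintro i j hi hj rfl
    have h1 := key i j
    rw [add_comm j i] at h1
    -- The two corrections `p_i p_j / 3` cancel.
    convert sub_mem h1 (key j i) using 1
    rw [sternOp_symmMonomial_of_even_of_odd hi hj]
    ext x y
    simp only [Pi.sub_apply, Pi.mul_apply, Pi.smul_apply, Pi.pow_apply, smul_eq_mul]
    ring
  induction hg using Submodule.span_induction with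
  | mem g hg =>
    obtain ⟨i, j, h, rfl⟩ := hg
    subst h
    rcases Nat.even_or_odd i with hi | hi
    · exact main i j hi ((Nat.odd_add'.mp hr).mpr hi) rfl
    · rw [symmMonomial_comm]
      exact main j i ((Nat.odd_add.mp hr).mp hi) hi (add_comm j i)
  | zero => simp
  | add a b _ _ ha hb => rw [map_add]; exact add_mem ha hb
  | smul c a _ ha => rw [map_smul]; exact Submodule.smul_mem _ _ ha

/-! ### Annihilating polynomials and recurrences -/

theorem sternSum_polyFun_eq (n : ℕ) (f : MvPolynomial (Fin 2) ℝ) :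
    sternSum (n + 1) (polyFun f) =
      1 / 2 * sternSum (n + 1) (polyFun f + fun x y => polyFun f y x) := by
  rw [← sternSumLin_apply (n + 1) (_ + _), map_add, sternSumLin_apply, sternSumLin_apply,
    sternSum_swap]
  ring

theorem finrank_sup_le_of_le {A B : Submodule ℝ (ℝ → ℝ → ℝ)} {a b : ℕ}
    (hA : FiniteDimensional ℝ A ∧ Module.finrank ℝ A ≤ a)
    (hB : FiniteDimensional ℝ B ∧ Module.finrank ℝ B ≤ b) :
    FiniteDimensional ℝ (A ⊔ B : Submodule ℝ (ℝ → ℝ → ℝ)) ∧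
      Module.finrank ℝ (A ⊔ B : Submodule ℝ (ℝ → ℝ → ℝ)) ≤ a + b := by
  have := hA.1
  have := hB.1
  exact ⟨inferInstance,
    (Submodule.finrank_add_le_finrank_add_finrank A B).trans (add_le_add hA.2 hB.2)⟩

/-- If an endomorphism commuting with `sternOp` sends the symmetric forms into a space of dimension
at most `N`, then some monic polynomial in `sternOp` of degree at most `N` kills its image. -/
theorem exists_monic_of_map_le {r N : ℕ} (R : Module.End ℝ (ℝ → ℝ → ℝ))
    (hR : Commute sternOp R) (A : Submodule ℝ (ℝ → ℝ → ℝ))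
    (hA : FiniteDimensional ℝ A ∧ Module.finrank ℝ A ≤ N)
    (hRA : ∀ g ∈ symmForms r, R g ∈ A) :
    ∃ p : ℝ[X], p.Monic ∧ p.natDegree ≤ N ∧ ∀ g ∈ symmForms r, R (aeval sternOp p g) = 0 := by
  have := hA.1
  have hle : (symmForms r).map R ≤ A := by
    rintro _ ⟨g, hg, rfl⟩
    exact hRA g hg
  have : FiniteDimensional ℝ ((symmForms r).map R) := Submodule.finiteDimensional_of_le hle
  -- `A` need not be stable under `sternOp`; the image of `R` is, since `R` commutes with it.
  obtain ⟨p, hp, hd, hz⟩ := exists_monic_aeval_eq_zero_on sternOp ((symmForms r).map R) (by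
    rintro _ ⟨g, hg, rfl⟩
    exact ⟨sternOp g, sternOp_mem_symmForms hg, (LinearMap.congr_fun hR.eq g).symm⟩)
  refine ⟨p, hp, hd.trans_le ((Submodule.finrank_mono hle).trans hA.2), fun g hg => ?_⟩
  have hc : Commute (aeval sternOp p) R := by
    rw [aeval_eq_sum_range]
    exact Commute.sum_left _ _ _ fun i _ => (hR.pow_left i).smul_left _
  rw [← hz (R g) ⟨g, hg, rfl⟩]
  exact (LinearMap.congr_fun hc.eq g).symm

theorem exists_monic_of_odd {r N₁ N₂ : ℕ} (hr : Odd r)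
    (h₁ : ∀ a b, 2 * a + 3 * b + 1 = r → b / 2 < N₁)
    (h₂ : ∀ a b, 2 * a + 3 * b + 2 = r → b / 2 < N₂) :
    ∃ p : ℝ[X], p.Monic ∧ p.natDegree ≤ N₁ + N₂ ∧
      ∀ g ∈ symmForms r, sternOp (aeval sternOp p g) = 0 :=
  exists_monic_of_map_le sternOp (Commute.refl _) _
    (finrank_sup_le_of_le (finrank_elemSpan_le _ 1 r N₁ h₁) (finrank_elemSpan_le _ 2 r N₂ h₂))
    fun _ => sternOp_mem_of_odd hr

theorem exists_monic_of_even {r : ℕ} (hr : Even r) :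
    ∃ p : ℝ[X], p.Monic ∧ p.natDegree ≤ 2 * (r / 6 + 1) ∧
      ∀ g ∈ symmForms r, (sternOp ^ 2 - 1 : Module.End ℝ (ℝ → ℝ → ℝ)) (aeval sternOp p g) = 0 := by
  have h := finrank_elemSpan_le 1 0 r (r / 6 + 1) (by omega)
  have := h.1
  have hm : ∀ R : Module.End ℝ (ℝ → ℝ → ℝ),
      FiniteDimensional ℝ ((elemSpan 1 0 r).map R) ∧
        Module.finrank ℝ ((elemSpan 1 0 r).map R) ≤ r / 6 + 1 := fun R =>
    ⟨inferInstance, (Submodule.finrank_map_le _ _).trans h.2⟩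
  obtain ⟨p, h1, h2, h3⟩ := exists_monic_of_map_le (r := r) (sternOp ^ 2 - 1)
    (((Commute.refl sternOp).pow_right 2).sub_right (Commute.one_right _)) _
    (finrank_sup_le_of_le (hm _) (hm _)) fun _ => sternOp_sq_sub_one_mem hr
  exact ⟨p, h1, by omega, h3⟩

theorem eq_add_mul_neg_one_pow_of_periodic {v : ℕ → ℝ} (hv : ∀ k, v (k + 2) = v k) (k : ℕ) :
    v k = (v 0 + v 1) / 2 + (v 0 - v 1) / 2 * (-1) ^ k := by
  induction k using Nat.twoStepInduction with
  | zero => ring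
  | one => ring
  | more k h0 _ => rw [hv, h0, pow_add]; simp

/-- The recurrence of `sternSum_recurrence` for a form and its symmetrization. -/
theorem sternSum_polyFun_recurrence {p : ℝ[X]} (hp : p.Monic) (f : MvPolynomial (Fin 2) ℝ)
    (n : ℕ) (hn : p.natDegree < n) :
    sternSum n (polyFun f) = (∑ j ∈ Finset.Icc 1 p.natDegree, -p.coeff (p.natDegree - j) *
      sternSum (n - j) (polyFun f)) + 1 / 2 * sternSum (n - p.natDegree)
        (aeval sternOp p (polyFun f + fun x y => polyFun f y x)) := by
  have hs : ∀ m, 0 < m → sternSum m (polyFun f) =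
      1 / 2 * sternSum m (polyFun f + fun x y => polyFun f y x) := by
    intro m hm
    obtain ⟨k, rfl⟩ : ∃ k, m = k + 1 := ⟨m - 1, by omega⟩
    exact sternSum_polyFun_eq k f
  rw [hs n (by omega), sternSum_recurrence hp _ n hn, mul_add, Finset.mul_sum]
  congr 1
  refine Finset.sum_congr rfl fun j hj => ?_
  rw [hs (n - j) (by have := (Finset.mem_Icc.mp hj).2; omega)]
  ring

theorem sternSum_zero_fun (n : ℕ) : sternSum n 0 = 0 := by simp [sternSum]

theorem exists_recurrence_of_odd {r N₁ N₂ : ℕ} (hr : Odd r)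
    (h₁ : ∀ a b, 2 * a + 3 * b + 1 = r → b / 2 < N₁)
    (h₂ : ∀ a b, 2 * a + 3 * b + 2 = r → b / 2 < N₂) :
    ∃ (l : ℕ) (a : ℕ → ℝ), l ≤ N₁ + N₂ ∧
      ∀ f : MvPolynomial (Fin 2) ℝ, f.IsHomogeneous r → ∀ᶠ n : ℕ in Filter.atTop,
        sternSum n (polyFun f) =
          ∑ j ∈ Finset.Icc 1 l, a j * sternSum (n - j) (polyFun f) := by
  obtain ⟨p, hp, hd, hz⟩ := exists_monic_of_odd hr h₁ h₂
  refine ⟨p.natDegree, fun j => -p.coeff (p.natDegree - j), hd, fun f hf => ?_⟩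
  -- One extra row lets the remaining sum absorb a further `sternOp`, after which it vanishes.
  filter_upwards [Filter.eventually_ge_atTop (p.natDegree + 2)] with n hn
  rw [sternSum_polyFun_recurrence hp f n (by omega)]
  obtain ⟨m, hm⟩ : ∃ m, n - p.natDegree = m + 2 := ⟨n - p.natDegree - 2, by omega⟩
  rw [hm, sternSum_succ, hz _ (polyFun_add_swap_mem hf), sternSum_zero_fun]
  ring

theorem exists_recurrence_of_even {r : ℕ} (hr : Even r) :
    ∃ (l : ℕ) (a : ℕ → ℝ), l ≤ 2 * (r / 6 + 1) + 2 ∧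
      ∀ f : MvPolynomial (Fin 2) ℝ, f.IsHomogeneous r → ∀ᶠ n : ℕ in Filter.atTop,
        sternSum n (polyFun f) =
          ∑ j ∈ Finset.Icc 1 l, a j * sternSum (n - j) (polyFun f) := by
  obtain ⟨p, hp, hd, hz⟩ := exists_monic_of_even hr
  have hq : (X ^ 2 - 1 : ℝ[X]).Monic := monic_X_pow_sub_C 1 two_ne_zero
  have hqd : (X ^ 2 - 1 : ℝ[X]).natDegree = 2 := natDegree_X_pow_sub_C (r := (1 : ℝ))
  refine ⟨((X ^ 2 - 1) * p).natDegree,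
    fun j => -((X ^ 2 - 1) * p).coeff (((X ^ 2 - 1) * p).natDegree - j), ?_, fun f hf => ?_⟩
  · rw [hq.natDegree_mul hp, hqd]
    omega
  · filter_upwards [Filter.eventually_gt_atTop ((X ^ 2 - 1) * p).natDegree] with n hn
    rw [sternSum_polyFun_recurrence (hq.mul hp) f n hn]
    have h := hz _ (polyFun_add_swap_mem hf)
    simp only [map_mul, map_sub, map_pow, aeval_X, map_one, Module.End.mul_apply, h,
      sternSum_zero_fun]
    ring

theorem exists_recurrence_add_of_even {r : ℕ} (hr : Even r) :
    ∃ (l : ℕ) (a : ℕ → ℝ), l ≤ 2 * (r / 6 + 1) ∧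
      ∀ f : MvPolynomial (Fin 2) ℝ, f.IsHomogeneous r → ∃ b c : ℝ,
        ∀ᶠ n : ℕ in Filter.atTop, sternSum n (polyFun f) =
          (∑ j ∈ Finset.Icc 1 l, a j * sternSum (n - j) (polyFun f)) + b + c * (-1) ^ n := by
  obtain ⟨p, hp, hd, hz⟩ := exists_monic_of_even hr
  refine ⟨p.natDegree, fun j => -p.coeff (p.natDegree - j), hd, fun f hf => ?_⟩
  set u := aeval sternOp p (polyFun f + fun x y => polyFun f y x) with hu
  have h2 : (sternOp ^ 2) u = u := sub_eq_zero.mp (hz _ (polyFun_add_swap_mem hf))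
  have hv := eq_add_mul_neg_one_pow_of_periodic (v := fun k => sternSum (k + 1) u) fun k => by
    have := sternSum_sternOp_pow k 2 u
    rw [h2] at this
    exact (congrArg (sternSum · u) (by omega)).trans this.symm
  -- The residual sum has period two in `m = n - deg p - 1`; the power of `-1` converts `(-1)^m` to
  -- `(-1)^n`.
  refine ⟨1 / 2 * ((sternSum 1 u + sternSum 2 u) / 2),
    1 / 2 * ((sternSum 1 u - sternSum 2 u) / 2) * (-1) ^ (p.natDegree + 1), ?_⟩
  filter_upwards [Filter.eventually_gt_atTop p.natDegree] with n hn
  obtain ⟨m, rfl⟩ : ∃ m, n = p.natDegree + (m + 1) := ⟨n - p.natDegree - 1, by omega⟩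
  have hpow : ((-1 : ℝ) ^ (p.natDegree + 1)) * (-1) ^ (p.natDegree + (m + 1)) = (-1) ^ m := by
    rw [← pow_add, show p.natDegree + 1 + (p.natDegree + (m + 1)) =
      2 * (p.natDegree + 1) + m by ring, pow_add, pow_mul]
    simp
  have hm := hv m
  simp only [zero_add, one_add_one_eq_two] at hm
  rw [sternSum_polyFun_recurrence hp f _ hn, ← hu, Nat.add_sub_cancel_left, hm,
    mul_assoc _ _ ((-1 : ℝ) ^ (p.natDegree + (m + 1))), hpow]
  ring

/-! ### Numerical bounds modulo six -/

theorem bracket_eq {a : Fin 3 → ℚ} {r : ℕ} (t : Fin 3) (h : r / 2 % 3 = t) :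
    bracket a r = a t := by
  rw [bracket]
  congr 1
  exact Fin.ext h

theorem mainTheorem2 (r : ℕ) :
    (Odd r → ∃ (l : ℕ) (a : ℕ → ℝ),
      (l : ℚ) ≤ (r : ℚ) / 3 + bracket ![2 / 3, 0, 1 / 3] r ∧
      ∀ f : MvPolynomial (Fin 2) ℝ, f.IsHomogeneous r →
        ∀ᶠ n : ℕ in Filter.atTop,
          sternSum n (polyFun f) =
            ∑ j ∈ Finset.Icc 1 l, a j * sternSum (n - j) (polyFun f)) ∧
    (Even r → ∃ (l : ℕ) (a : ℕ → ℝ),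
      (l : ℚ) ≤ (r : ℚ) / 3 + bracket ![4, 10 / 3, 8 / 3] r ∧
      ∀ f : MvPolynomial (Fin 2) ℝ, f.IsHomogeneous r →
        ∀ᶠ n : ℕ in Filter.atTop,
          sternSum n (polyFun f) =
            ∑ j ∈ Finset.Icc 1 l, a j * sternSum (n - j) (polyFun f)) ∧
    (Even r → ∃ (l : ℕ) (a : ℕ → ℝ),
      (l : ℚ) ≤ (r : ℚ) / 3 + bracket ![2, 4 / 3, 2 / 3] r ∧
      ∀ f : MvPolynomial (Fin 2) ℝ, f.IsHomogeneous r → ∃ b c : ℝ,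
        ∀ᶠ n : ℕ in Filter.atTop,
          sternSum n (polyFun f) =
            (∑ j ∈ Finset.Icc 1 l, a j * sternSum (n - j) (polyFun f)) + b + c * (-1) ^ n) := by
  obtain ⟨m, k, hk, rfl⟩ : ∃ m k, k < 6 ∧ r = 6 * m + k :=
    ⟨r / 6, r % 6, Nat.mod_lt _ (by norm_num), by omega⟩
  have hdiv : (6 * m + k) / 6 = m := by omega
  refine ⟨fun hr => ?_, fun hr => ?_, fun hr => ?_⟩
  · have hcase : k = 1 ∨ k = 3 ∨ k = 5 := by
      obtain ⟨c, hc⟩ := hr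
      omega
    rcases hcase with rfl | rfl | rfl
    -- `N₁` and `N₂` count the `b` with `3b ≤ r - 1`, `b` even, and `3b ≤ r - 2`, `b` odd.
    · obtain ⟨l, a, hl, h⟩ := exists_recurrence_of_odd (N₁ := m + 1) (N₂ := m) hr
        (by omega) (by omega)
      refine ⟨l, a, ?_, h⟩
      rw [bracket_eq 0 (show _ = 0 by omega)]
      have : (l : ℚ) ≤ m + 1 + m := by exact_mod_cast hl
      simp
      linarith
    · obtain ⟨l, a, hl, h⟩ := exists_recurrence_of_odd (N₁ := m + 1) (N₂ := m) hr
        (by omega) (by omega)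
      refine ⟨l, a, ?_, h⟩
      rw [bracket_eq 1 (show _ = 1 by omega)]
      have : (l : ℚ) ≤ m + 1 + m := by exact_mod_cast hl
      simp
      linarith
    · obtain ⟨l, a, hl, h⟩ := exists_recurrence_of_odd (N₁ := m + 1) (N₂ := m + 1) hr
        (by omega) (by omega)
      refine ⟨l, a, ?_, h⟩
      rw [bracket_eq 2 (show _ = 2 by omega)]
      have : (l : ℚ) ≤ m + 1 + (m + 1) := by exact_mod_cast hl
      simp
      linarith
  all_goals
    have hcase : k = 0 ∨ k = 2 ∨ k = 4 := by
      obtain ⟨c, hc⟩ := hr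
      omega
  · obtain ⟨l, a, hl, h⟩ := exists_recurrence_of_even hr
    refine ⟨l, a, ?_, h⟩
    rw [hdiv] at hl
    have : (l : ℚ) ≤ 2 * (m + 1) + 2 := by exact_mod_cast hl
    rcases hcase with rfl | rfl | rfl
    · rw [bracket_eq 0 (show _ = 0 by omega)]
      simp
      linarith
    · rw [bracket_eq 1 (show _ = 1 by omega)]
      simp
      linarith
    · rw [bracket_eq 2 (show _ = 2 by omega)]
      simp
      linarith
  · obtain ⟨l, a, hl, h⟩ := exists_recurrence_add_of_even hr
    refine ⟨l, a, ?_, h⟩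
    rw [hdiv] at hl
    have : (l : ℚ) ≤ 2 * (m + 1) := by exact_mod_cast hl
    rcases hcase with rfl | rfl | rfl
    · rw [bracket_eq 0 (show _ = 0 by omega)]
      simp
      linarith
    · rw [bracket_eq 1 (show _ = 1 by omega)]
      simp
      linarith
    · rw [bracket_eq 2 (show _ = 2 by omega)]
      simp
      linarith
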